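/- Let $R$ be a finite commutative ring with unit in which $2$ is invertible, and let $\mathbb{K}$ be a (left) Noetherian ring, not necessarily commutative. An orthogonal $R$-module is a pair $(V,B)$ of a free $R$-module $V$ of finite rank and a symmetric bilinear form $B:V\times V\to R$ that induces an isomorphism $V\to \operatorname{Hom}_R(V,R)$. Let $\mathcal{A}=\mathrm{OrI}(R)$ be the category whose objects are the orthogonal $R$-modules and whose morphisms $(V,B)\to(W,B')$ are the isometries, that is, the $R$-linear maps $\phi:V\to W$ with $B'(\phi(v),\phi(w))=B(v,w)$ for all $v,w\in V$. An $\mathcal{A}$-module is a functor $M$ from $\mathcal{A}$ to the category of left $\mathbb{K}$-modules; it is finitely generated if there are finitely many objects $C_1,\dots,C_n$ of $\mathcal{A}$ and elements $x_i\in M(C_i)$ such that the only submodule $S$ of $M$ (a family of submodules $S(V)\subseteq M(V)$ preserved by all maps $M(f)$) with $x_i\in S(C_i)$ for all $i$ is $M$ itself. For $N\ge 0$ let $\mathcal{A}_{\le N}$ be the full subcategory of $\mathcal{A}$ spanned by - the objects of rank at most $N-1$, and - the objects isometric to $R^N$ with the bilinear form whose matrix in the standard basis is the identity. Theorem (Central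 stability). Let $M$ be a finitely generated $\mathcal{A}$-module. Then there is an $N_0$ such that for all $N\ge N_0$ the functor $M$, together with the identity transformation of $M|_{\mathcal{A}_{\le N}}$, is the left Kan extension of $M|_{\mathcal{A}_{\le N}}$ along the inclusion functor $\mathcal{A}_{\le N}\to\mathcal{A}$. -/

import Mathlib

open CategoryTheory

universe u w x

/-- An orthogonal module over `R`: a free `R`-module of finite rank with a symmetric bilinear form
which is non-degenerate, i.e. the induced map `V → Hom_R(V, R)` is an isomorphism. -/
structure OrI (R : Type u) [CommRing R] where
  carrier : Type u
  [addCommGroup : AddCommGroup carrier]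
  [module : Module R carrier]
  [free : Module.Free R carrier]
  [finite : Module.Finite R carrier]
  form : carrier →ₗ[R] Module.Dual R carrier
  symm : ∀ v w, form v w = form w v
  nondegenerate : Function.Bijective form

namespace OrI

variable {R : Type u} [CommRing R]

instance : CoeSort (OrI R) (Type u) := ⟨OrI.carrier⟩

attribute [instance] OrI.addCommGroup OrI.module OrI.free OrI.finite

/-- Isometries: `R`-linear maps preserving the forms (not required to be bijective). -/
@[ext]
structure Hom (V W : OrI R) where
  toLinearMap : V →ₗ[R] W
  map_form : ∀ v w, W.form (toLinearMap v) (toLinearMap w) = V.form v w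

/-- The category of orthogonal `R`-modules and isometries. -/
instance : Category (OrI R) where
  Hom V W := Hom V W
  id V := ⟨LinearMap.id, fun _ _ => rfl⟩
  comp f g := ⟨g.toLinearMap ∘ₗ f.toLinearMap, fun v w => by
    simp [g.map_form, f.map_form]⟩

/-- The orthogonal modules that either have rank at most `N - 1`, or are isometric to `R ^ N` with
the form whose matrix in the standard basis is the identity. -/
def rankLE (R : Type u) [CommRing R] (N : ℕ) : ObjectProperty (OrI R) := fun V =>
  Module.finrank R V < N ∨
    ∃ e : V ≃ₗ[R] (Fin N → R), ∀ v w, V.form v w = ∑ i, e v i * e w i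

end OrI

/-- A submodule of a `C`-module `M` over `K`, i.e. of a functor from `C` to `K`-modules. -/
structure CatSubmodule {C : Type*} [Category* C] {K : Type w} [Ring K]
    (M : C ⥤ ModuleCat.{x} K) where
  obj : ∀ X : C, Submodule K (M.obj X)
  map_mem : ∀ {X Y : C} (f : X ⟶ Y) {m : M.obj X}, m ∈ obj X → M.map f m ∈ obj Y

/-- A `C`-module is finitely generated if there are finitely many elements `m i ∈ M (X i)` such that
the only submodule of `M` containing all of them is `M`. -/
def IsFinitelyGenerated {C : Type*} [Category* C] {K : Type w} [Ring K]
    (M : C ⥤ ModuleCat.{x} K) : Prop :=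
  ∃ (n : ℕ) (X : Fin n → C) (m : ∀ i, M.obj (X i)),
    ∀ S : CatSubmodule M, (∀ i, m i ∈ S.obj (X i)) → ∀ Y, S.obj Y = ⊤

/-!
A finitely generated `OrI R`-module `M` is a quotient of `P = ⨁ i, K[Hom(C i, -)]`. The point is
that `P` is noetherian (`OrI.exists_finite_generators`). Granting this, the relations between the
generators of `M` are generated by finitely many relations as well. Once `N` exceeds the ranks of
all objects carrying these generators and relations, a natural transformation defined on the
objects of rank less than `N` extends uniquely to `M`: it is determined by the images of the
generators, and these satisfy all relations because they satisfy the generating ones.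

Noetherianity is proved by a Gröbner basis argument. As `2` is invertible and `R` is finite, every
orthogonal module has an orthogonal basis (`OrI.exists_iso_diag`), so it suffices to look at the
modules `OrI.diag a` with basis vectors of norms `a 1, …, a n`. An isometry `C ⟶ diag a` is a word
of length `n` whose letters are linear forms on `C`, and each letter is decorated with the norm of
the corresponding basis vector; there are finitely many decorated letters. A surjection
`f : Fin n' → Fin n` sends the `i`-th basis vector of `diag a` to the sum of the basis vectors in its
fibre over `i`. This is an isometry `diag a ⟶ diag (a ∘ f)` if all fibres have cardinality `1` in
`R`, and on words it is precomposition with `f`. If, moreover, the least elements of the fibres occur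
in increasing order, this precomposition is strictly monotone for the lexicographic order
(`IsUnimodularSurjection.lex_lt`).

It remains to see that divisibility of words by such surjections is a well-quasi-order
(`exists_subseq_isUnimodularSurjection`). In any sequence of words one may pass to a subsequence
along which the set of letters used, and the number of occurrences in `R` of each letter, are
constant. By Higman's lemma, applied to words in which first occurrences are marked, one may also
assume that earlier words are subwords of later ones, with first occurrences going to first
occurrences. Mapping each of the additional letters of a later word to the first occurrence of the
same letter in an earlier one gives the required surjection. The Gröbner basis argument itself is
`exists_finite_generators_of_wqo`.
-/

/-! ### Well-quasi-ordering of words -/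

/-- A map `f : Fin n' → Fin n` such that `a ↦ a ∘ f` is strictly monotone for the lexicographic
order (this is what the section `g`, the first element of each fibre, is for) and such that all
fibres have cardinality `1` in `R`, expressed as invariance of sums. -/
structure IsUnimodularSurjection (R : Type*) [CommRing R] {n n' : ℕ} (f : Fin n' → Fin n) :
    Prop where
  exists_section : ∃ g : Fin n → Fin n', (∀ i, f (g i) = i) ∧ ∀ i j, j < g i → f j < i
  sum_comp : ∀ F : Fin n → R, ∑ j, F (f j) = ∑ i, F i

/-- The letters of a word, each with a mark saying whether it is the first occurrence. -/
def markFirst {A : Type*} {n : ℕ} (a : Fin n → A) (i : Fin n) : A × Prop :=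
  (a i, ∀ j < i, a j ≠ a i)

theorem exists_first_occurrence {A : Type*} {n : ℕ} (a : Fin n → A) (i : Fin n) :
    ∃ k, a k = a i ∧ ∀ j < k, a j ≠ a k := by
  obtain ⟨k, hk, hmin⟩ := WellFounded.has_min (wellFounded_lt (α := Fin n)) {k | a k = a i}
    ⟨i, rfl⟩
  exact ⟨k, hk, fun j hj h => hmin j (h.trans hk) hj⟩

/-- If the marked word of `a` is a subword of the marked word of `b`, the two words use the same
letters, and each letter occurs equally often in both when counted in `R`, then `b` is obtained
from `a` by inserting copies of letters after their first occurrence. -/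
theorem exists_isUnimodularSurjection {R : Type*} [CommRing R] {A : Type*} {n n' : ℕ}
    (a : Fin n → A) (b : Fin n' → A) (g : Fin n ↪o Fin n')
    (hg : ∀ i, markFirst a i = markFirst b (g i))
    (hrange : Set.range a = Set.range b)
    (hcount : ∀ x, (Nat.card {i // a i = x} : R) = Nat.card {j // b j = x}) :
    ∃ f : Fin n' → Fin n, IsUnimodularSurjection R f ∧ b = a ∘ f := by
  classical
  have hfst : ∀ j, ∃ k, a k = b j ∧ ∀ l < k, a l ≠ b j := by
    intro j
    obtain ⟨i, hi⟩ : b j ∈ Set.range a := hrange ▸ Set.mem_range_self j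
    obtain ⟨k, hk, hk'⟩ := exists_first_occurrence a i
    exact ⟨k, hk.trans hi, fun l hl h => hk' l hl (by rw [h, hk, hi])⟩
  have hga : ∀ i, b (g i) = a i := fun i => (congrArg Prod.fst (hg i)).symm
  let f : Fin n' → Fin n := fun j =>
    if h : ∃ i, g i = j then h.choose else (hfst j).choose
  have hfg : ∀ i, f (g i) = i := by
    intro i
    have h : ∃ i', g i' = g i := ⟨i, rfl⟩
    simp only [f, dif_pos h]
    exact g.injective h.choose_spec
  have hf' : ∀ j, (¬ ∃ i, g i = j) → a (f j) = b j ∧ ∀ l < f j, a l ≠ b j := by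
    intro j h
    simp only [f, dif_neg h]
    exact (hfst j).choose_spec
  refine ⟨f, ⟨⟨g, hfg, ?_⟩, ?_⟩, ?_⟩
  · intro i j hj
    by_cases h : ∃ i', g i' = j
    · obtain ⟨i', rfl⟩ := h
      rw [hfg]
      exact g.lt_iff_lt.1 hj
    · obtain ⟨h1, h2⟩ := hf' j h
      -- `f j` is a first occurrence in `a`, hence `g (f j)` is one in `b`, of the letter `b j`.
      have h3 : ∀ l < g (f j), b l ≠ b (g (f j)) := by
        have := congrArg Prod.snd (hg (f j))
        simp only [markFirst] at this
        rw [← this, h1]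
        exact h2
      have h4 : g (f j) ≤ j := by
        by_contra hlt
        exact h3 j (not_le.1 hlt) (by rw [hga, h1])
      exact g.lt_iff_lt.1 (h4.trans_lt hj)
  · intro F
    -- At an inserted position `j`, the value `F (f j)` depends only on the letter `b j`.
    let H : A → R := fun x =>
      if h : ∃ k, a k = x ∧ ∀ l < k, a l ≠ x then F h.choose else 0
    have hH : ∀ j, (¬ ∃ i, g i = j) → F (f j) = H (b j) := by
      intro j h
      simp only [f, dif_neg h, H, dif_pos (hfst j)]
    have hsum : ∀ {m : ℕ} (c : Fin m → A), (∑ j, H (c j)) =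
        ∑ x ∈ Finset.univ.image c, (Nat.card {i // c i = x} : R) * H x := by
      intro m c
      rw [Finset.sum_comp]
      refine Finset.sum_congr rfl fun x _ => ?_
      rw [nsmul_eq_mul, Nat.card_eq_fintype_card, Fintype.card_subtype]
    have himage : Finset.univ.image a = Finset.univ.image b := by
      apply Finset.coe_injective
      simpa using hrange
    have hHH : ∑ j, H (b j) = ∑ i, H (a i) := by
      rw [hsum, hsum, himage]
      exact Finset.sum_congr rfl fun x _ => by rw [hcount]
    have h1 : ∑ j, (F (f j) - H (b j)) = ∑ i, (F i - H (a i)) := by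
      symm
      refine Finset.sum_of_injOn g g.injective.injOn (by simp) ?_ ?_
      · intro j _ hj
        rw [hH j (fun ⟨i, hi⟩ => hj ⟨i, by simp, hi⟩), sub_self]
      · intro i _
        rw [hfg, hga]
    rw [Finset.sum_sub_distrib, Finset.sum_sub_distrib, hHH] at h1
    exact sub_left_injective h1
  · funext j
    by_cases h : ∃ i, g i = j
    · obtain ⟨i, rfl⟩ := h
      simp [hfg, hga]
    · exact (hf' j h).1.symm

theorem exists_subseq_const {Q : Type*} [Finite Q] (c : ℕ → Q) :
    ∃ (φ : ℕ ↪o ℕ) (q : Q), ∀ k, c (φ k) = q := by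
  classical
  obtain ⟨q, hq⟩ := Finite.exists_infinite_fiber c
  exact ⟨Nat.orderEmbeddingOfSet (c ⁻¹' {q}), q,
    fun k => (Nat.Subtype.ofNat (c ⁻¹' {q}) k).2⟩

/-- Higman's lemma for words over a finite alphabet, refined by the pigeonhole principle. -/
theorem exists_subseq_isUnimodularSurjection (R : Type*) [CommRing R] [Finite R] {A : Type*}
    [Finite A] (s : ℕ → Σ n, Fin n → A) :
    ∃ φ : ℕ ↪o ℕ, ∀ k l, k < l → ∃ f : Fin (s (φ l)).1 → Fin (s (φ k)).1,
      IsUnimodularSurjection R f ∧ (s (φ l)).2 = (s (φ k)).2 ∘ f := by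
  obtain ⟨φ, q, hφ⟩ := exists_subseq_const (Q := Set A × (A → R))
    fun k => (Set.range (s k).2, fun x => (Nat.card {i // (s k).2 i = x} : R))
  have hpwo := Set.PartiallyWellOrderedOn.partiallyWellOrderedOn_sublistForall₂
    (α := A × Prop) Eq (s := Set.univ) (Set.finite_univ.partiallyWellOrderedOn)
  have : IsPreorder (List (A × Prop)) (List.SublistForall₂ Eq) := {}
  obtain ⟨ψ, hψ⟩ := hpwo.exists_monotone_subseq
    (f := fun k => List.ofFn (markFirst (s (φ k)).2)) (fun _ _ _ => Set.mem_univ _)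
  refine ⟨ψ.trans φ, fun k l hkl => ?_⟩
  have hsub : 
      (List.ofFn (markFirst (s (φ (ψ k))).2)).Sublist (List.ofFn (markFirst (s (φ (ψ l))).2)) := by
    obtain ⟨t, ht, ht'⟩ := List.sublistForall₂_iff.1 (hψ k l hkl.le)
    rw [List.forall₂_eq_eq_eq] at ht
    exact ht ▸ ht'
  obtain ⟨g, hg⟩ := List.sublist_iff_exists_fin_orderEmbedding_get_eq.1 hsub
  have h := (hφ (ψ k)).trans (hφ (ψ l)).symm
  refine exists_isUnimodularSurjection _ _
    ((Fin.castOrderIso List.length_ofFn.symm).toOrderEmbedding.trans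
      (g.trans (Fin.castOrderIso List.length_ofFn).toOrderEmbedding)) (fun i => ?_)
    (congrArg Prod.fst h) (fun x => congrFun (congrArg Prod.snd h) x)
  have hi := hg (Fin.cast List.length_ofFn.symm i)
  rw [List.get_ofFn, List.get_ofFn] at hi
  exact hi

/-! ### Gröbner bases for families of free modules -/

section Groebner

variable {O : Type*} {B : O → Type*} {K : Type*} [Ring K]

/-- A family of submodules `S o` of the free modules on `B o` is stable under a family of maps
`B o → B o'` if the induced linear maps preserve it. -/
def IsStableFamily (T : ∀ o o', Set (B o → B o')) (S : ∀ o, Submodule K (B o →₀ K)) : Prop :=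
  ∀ ⦃o o'⦄, ∀ f ∈ T o o', ∀ p ∈ S o, Finsupp.lmapDomain K K f p ∈ S o'

/-- The left ideal of the coefficients at `b` of elements of `S` whose monomials are at most `b`. -/
noncomputable def leadingCoeffIdeal [∀ o, LinearOrder (B o)] (S : ∀ o, Submodule K (B o →₀ K))
    (b : Σ o, B o) : Submodule K K :=
  (S b.1 ⊓ Finsupp.supported K K (Set.Iic b.2)).map (Finsupp.lapply b.2)

variable [∀ o, LinearOrder (B o)]

theorem leadingCoeffIdeal_le_of_map {T : ∀ o o', Set (B o → B o')}
    (hT : ∀ o o', ∀ f ∈ T o o', StrictMono f) {S : ∀ o, Submodule K (B o →₀ K)}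
    (hS : IsStableFamily T S) {b c : Σ o, B o} {f : B b.1 → B c.1} (hf : f ∈ T b.1 c.1)
    (hfb : f b.2 = c.2) : leadingCoeffIdeal S b ≤ leadingCoeffIdeal S c := by
  rintro _ ⟨p, ⟨hp, hpb⟩, rfl⟩
  refine ⟨Finsupp.lmapDomain K K f p, ⟨hS f hf p hp, ?_⟩, ?_⟩
  · have h := Submodule.mem_map_of_mem (f := Finsupp.lmapDomain K K f) hpb
    rw [Finsupp.lmapDomain_supported] at h
    refine Finsupp.supported_mono ?_ h
    rintro _ ⟨d, hd, rfl⟩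
    exact ((hT _ _ f hf).monotone hd).trans hfb.le
  · simp only [Finsupp.lapply_apply, Finsupp.lmapDomain_apply, ← hfb]
    exact Finsupp.mapDomain_apply (hT _ _ f hf).injective _ _

/-- A stable subfamily with the same ideals of leading coefficients is everything. -/
theorem le_of_leadingCoeffIdeal_le [∀ o, Finite (B o)] {S S' : ∀ o, Submodule K (B o →₀ K)}
    (hle : ∀ o, S' o ≤ S o) (h : ∀ b, leadingCoeffIdeal S b ≤ leadingCoeffIdeal S' b) (o : O) :
    S o ≤ S' o := by
  have key : ∀ b : B o, ∀ p ∈ S o, p ∈ Finsupp.supported K K (Set.Iic b) → p ∈ S' o := by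
    intro b
    induction b using WellFoundedLT.induction with
    | ind b ih =>
    intro p hp hpb
    obtain ⟨q, ⟨hq, hqb⟩, hqp⟩ := h ⟨o, b⟩ ⟨p, ⟨hp, hpb⟩, rfl⟩
    simp only [Finsupp.lapply_apply] at hqp
    suffices p - q ∈ S' o by simpa using add_mem this hq
    have hd : p - q ∈ S o := sub_mem hp (hle o hq)
    have hdb : ∀ c ∈ (p - q).support, c < b := by
      intro c hc
      have h1 : c ≤ b := (Finsupp.mem_supported K _).1 (sub_mem hpb hqb) hc
      refine lt_of_le_of_ne h1 ?_
      rintro rfl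
      simp [hqp] at hc
    by_cases hne : (p - q).support.Nonempty
    · refine ih _ (hdb _ (Finset.max'_mem _ hne)) _ hd ((Finsupp.mem_supported K _).2 ?_)
      exact fun c hc => Finset.le_max' _ _ hc
    · rw [Finset.not_nonempty_iff_eq_empty, Finsupp.support_eq_empty] at hne
      rw [hne]
      exact zero_mem _
  intro p hp
  by_cases hne : p.support.Nonempty
  · exact key (p.support.max' hne) p hp
      ((Finsupp.mem_supported K _).2 fun c hc => Finset.le_max' _ _ hc)
  · rw [Finset.not_nonempty_iff_eq_empty, Finsupp.support_eq_empty] at hne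
    rw [hne]
    exact zero_mem _

/-- A Gröbner basis criterion for the noetherian property: the transition maps are strictly
monotone, and each sequence of monomials has a subsequence in which the earlier ones divide the
later ones. -/
theorem exists_finite_generators_of_wqo [IsNoetherianRing K] [∀ o, Finite (B o)]
    {T : ∀ o o', Set (B o → B o')} (hT : ∀ o o', ∀ f ∈ T o o', StrictMono f)
    (hwqo : ∀ s : ℕ → Σ o, B o, ∃ φ : ℕ ↪o ℕ, ∀ k l, k < l →
      ∃ f ∈ T (s (φ k)).1 (s (φ l)).1, f (s (φ k)).2 = (s (φ l)).2)
    {S : ∀ o, Submodule K (B o →₀ K)} (hS : IsStableFamily T S) :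
    ∃ E : Set (Σ o, B o →₀ K), E.Finite ∧ (∀ e ∈ E, e.2 ∈ S e.1) ∧
      ∀ S' : ∀ o, Submodule K (B o →₀ K), IsStableFamily T S' → (∀ e ∈ E, e.2 ∈ S' e.1) →
        ∀ o, S o ≤ S' o := by
  classical
  -- Finitely many monomials control all the ideals of leading coefficients.
  obtain ⟨F, hF⟩ : ∃ F : Finset (Σ o, B o), ∀ c : Σ o, B o, ∃ b ∈ F,
      (∃ f ∈ T b.1 c.1, f b.2 = c.2) ∧ leadingCoeffIdeal S c ≤ leadingCoeffIdeal S b := by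
    by_contra! hcon
    obtain ⟨s, -, hs⟩ := exists_seq_of_forall_finset_exists (fun _ : Σ o, B o => True)
      (fun b c => (∃ f ∈ T b.1 c.1, f b.2 = c.2) →
        ¬ leadingCoeffIdeal S c ≤ leadingCoeffIdeal S b)
      (fun F _ => (hcon F).imp fun c hc => ⟨trivial, fun b hb => by
        rintro ⟨f, hf, hfb⟩
        exact hc b hb ⟨f, hf, hfb⟩⟩)
    obtain ⟨φ, hφ⟩ := hwqo s
    have hmono : Monotone fun k => leadingCoeffIdeal S (s (φ k)) := by
      intro k l hkl
      rcases hkl.eq_or_lt with rfl | hkl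
      · exact le_rfl
      · obtain ⟨f, hf, hfb⟩ := hφ k l hkl
        exact leadingCoeffIdeal_le_of_map hT hS hf hfb
    obtain ⟨k, hk⟩ := monotone_stabilizes_iff_noetherian.2 ‹IsNoetherianRing K› ⟨_, hmono⟩
    exact hs _ _ (φ.lt_iff_lt.2 k.lt_succ_self) (hφ _ _ k.lt_succ_self) (hk _ k.le_succ).ge
  have hfg : ∀ b, ∃ t : Finset (B b.1 →₀ K), (∀ p ∈ t, p ∈ S b.1) ∧
      ∀ S' : ∀ o, Submodule K (B o →₀ K), (∀ p ∈ t, p ∈ S' b.1) →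
        leadingCoeffIdeal S b ≤ leadingCoeffIdeal S' b := by
    intro b
    obtain ⟨t, ht, hspan⟩ := Submodule.fg_def.1
      (IsNoetherian.noetherian (leadingCoeffIdeal S b))
    have hpre : ∀ y ∈ t, ∃ p ∈ S b.1 ⊓ Finsupp.supported K K (Set.Iic b.2), p b.2 = y := by
      intro y hy
      have : y ∈ leadingCoeffIdeal S b := hspan ▸ Submodule.subset_span hy
      exact this
    choose! r hr hrb using hpre
    refine ⟨ht.toFinset.image r, ?_, ?_⟩
    · intro p hp
      obtain ⟨y, hy, rfl⟩ := Finset.mem_image.1 hp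
      exact (hr y (ht.mem_toFinset.1 hy)).1
    · intro S' hS'
      rw [← hspan, Submodule.span_le]
      intro y hy
      exact ⟨r y, ⟨hS' _ (Finset.mem_image_of_mem _ (ht.mem_toFinset.2 hy)), (hr y hy).2⟩,
        hrb y hy⟩
  choose t ht ht' using hfg
  refine ⟨⋃ b ∈ F, Sigma.mk b.1 '' (t b : Set (B b.1 →₀ K)), ?_, ?_, ?_⟩
  · exact F.finite_toSet.biUnion fun b _ => (t b).finite_toSet.image _
  · simp only [Set.mem_iUnion]
    rintro _ ⟨b, _, p, hp, rfl⟩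
    exact ht b p hp
  · intro S' hS' hE o
    refine (le_of_leadingCoeffIdeal_le (S' := fun o => S o ⊓ S' o) (fun o => inf_le_left) ?_
      o).trans inf_le_right
    intro c
    obtain ⟨b, hb, ⟨f, hf, hfb⟩, hcb⟩ := hF c
    have hSS' : IsStableFamily T fun o => S o ⊓ S' o := fun o o' f hf p hp =>
      ⟨hS f hf p hp.1, hS' f hf p hp.2⟩
    refine hcb.trans ((ht' b (fun o => S o ⊓ S' o) fun p hp => ⟨ht b p hp, ?_⟩).trans
      (leadingCoeffIdeal_le_of_map hT hSS' hf hfb))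
    exact hE ⟨b.1, p⟩ (Set.mem_iUnion₂.2 ⟨b, hb, p, hp, rfl⟩)

end Groebner

/-! ### Orthogonal bases -/

section Diagonalization

open Matrix

variable {R : Type*} [CommRing R]

/-- The symmetric form with matrix `S` has an orthogonal basis. -/
def Matrix.IsCongruentToDiagonal {ι : Type*} [Fintype ι] [DecidableEq ι] (S : Matrix ι ι R) :
    Prop :=
  ∃ (P : Matrix ι ι R) (d : ι → R), IsUnit P.det ∧ S = Pᵀ * diagonal d * P

theorem Matrix.IsCongruentToDiagonal.congr {ι : Type*} [Fintype ι] [DecidableEq ι]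
    {S : Matrix ι ι R} (hS : S.IsCongruentToDiagonal) {Q : Matrix ι ι R} (hQ : IsUnit Q.det) :
    (Qᵀ * S * Q).IsCongruentToDiagonal := by
  obtain ⟨P, d, hP, rfl⟩ := hS
  refine ⟨P * Q, d, by rw [det_mul]; exact hP.mul hQ, ?_⟩
  simp only [transpose_mul, Matrix.mul_assoc]

theorem Matrix.IsCongruentToDiagonal.of_congr {ι : Type*} [Fintype ι] [DecidableEq ι]
    {S Q : Matrix ι ι R} (hQ : IsUnit Q.det) (hS : (Qᵀ * S * Q).IsCongruentToDiagonal) :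
    S.IsCongruentToDiagonal := by
  have h := hS.congr (Q := Q⁻¹) (isUnit_nonsing_inv_det Q hQ)
  have hQ' : IsUnit Qᵀ.det := by rwa [det_transpose]
  rwa [transpose_nonsing_inv, ← Matrix.mul_assoc, ← Matrix.mul_assoc, nonsing_inv_mul _ hQ',
    Matrix.one_mul, mul_nonsing_inv_cancel_right _ _ hQ] at h

theorem Matrix.IsCongruentToDiagonal.of_submatrix {ι κ : Type*} [Fintype ι] [DecidableEq ι]
    [Fintype κ] [DecidableEq κ] (e : ι ≃ κ) {S : Matrix κ κ R}
    (hS : (S.submatrix e e).IsCongruentToDiagonal) : S.IsCongruentToDiagonal := by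
  obtain ⟨P, d, hP, h⟩ := hS
  refine ⟨P.submatrix e.symm e.symm, d ∘ e.symm, by rwa [det_submatrix_equiv_self], ?_⟩
  have := congrArg (fun X => X.submatrix e.symm e.symm) h
  simp only [submatrix_submatrix, Equiv.self_comp_symm, submatrix_id_id] at this
  rw [this, transpose_submatrix, ← submatrix_diagonal_equiv, submatrix_mul_equiv,
    submatrix_mul_equiv]

/-- The form with matrix `[a, b; bᵀ, D]` takes a unit value at a vector with first coordinate `1`.
Modulo a maximal ideal `m` this follows by polarization from the fact that the first row of the
matrix is not zero modulo `m`; the Chinese remainder theorem does the rest. -/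
theorem exists_isUnit_quadratic [Finite (MaximalSpectrum R)] (h2 : IsUnit (2 : R)) {ι : Type*}
    [Fintype ι] [DecidableEq ι] (a : R) (b : ι → R) (D : Matrix ι ι R)
    (h : ∀ m : Ideal R, m.IsMaximal → ¬ (a ∈ m ∧ ∀ i, b i ∈ m)) :
    ∃ w : ι → R, IsUnit (a + 2 * (b ⬝ᵥ w) + w ⬝ᵥ (D *ᵥ w)) := by
  have hloc : ∀ m : MaximalSpectrum R, ∃ w : ι → R,
      a + 2 * (b ⬝ᵥ w) + w ⬝ᵥ (D *ᵥ w) ∉ m.asIdeal := by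
    intro m
    by_contra! hcon
    refine h m.asIdeal m.isMaximal ⟨by simpa using hcon 0, fun i => ?_⟩
    have h1 := sub_mem (hcon (Pi.single i 1)) (hcon (-Pi.single i 1))
    have h2' : (2 * 2 : R) * b i ∈ m.asIdeal := by
      convert h1 using 1
      simp [mulVec_neg]
      ring
    exact (Ideal.unit_mul_mem_iff_mem _ (h2.mul h2)).1 h2'
  choose w hw using hloc
  have hcop : Pairwise (Function.onFun IsCoprime fun m : MaximalSpectrum R => m.asIdeal) :=
    fun m m' hne => by
      have := m.isMaximal
      have := m'.isMaximal
      exact Ideal.isCoprime_of_isMaximal fun h => hne (MaximalSpectrum.ext h)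
  choose v hv using fun i => Ideal.exists_forall_sub_mem_ideal hcop fun m => w m i
  refine ⟨v, ?_⟩
  by_contra hu
  obtain ⟨m, hm, hmem⟩ := exists_max_ideal_of_mem_nonunits hu
  apply hw ⟨m, hm⟩
  have hvw : ∀ i, Ideal.Quotient.mk m (w ⟨m, hm⟩ i) = Ideal.Quotient.mk m (v i) := fun i =>
    ((Ideal.Quotient.mk_eq_mk_iff_sub_mem _ _).2 (hv i ⟨m, hm⟩)).symm
  rw [← Ideal.Quotient.eq_zero_iff_mem] at hmem ⊢
  rw [← hmem]
  simp only [dotProduct, mulVec, map_add, map_mul, map_sum, hvw]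

theorem Matrix.isCongruentToDiagonal_sum [Finite (MaximalSpectrum R)] (h2 : IsUnit (2 : R))
    {ι : Type*} [Fintype ι] [DecidableEq ι]
    (ih : ∀ S : Matrix ι ι R, S.IsSymm → IsUnit S.det → S.IsCongruentToDiagonal)
    (S : Matrix (Unit ⊕ ι) (Unit ⊕ ι) R) (hS : S.IsSymm) (hdet : IsUnit S.det) :
    S.IsCongruentToDiagonal := by
  -- First arrange that the entry in the upper left corner is a unit.
  wlog hunit : IsUnit (S (Sum.inl ()) (Sum.inl ())) generalizing S
  · obtain ⟨w, hw⟩ := exists_isUnit_quadratic h2 (S (Sum.inl ()) (Sum.inl ()))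
      (fun i => S (Sum.inl ()) (Sum.inr i)) S.toBlocks₂₂ (by
        rintro m hm ⟨ha, hb⟩
        refine hm.ne_top (Ideal.eq_top_of_isUnit_mem _ ?_ hdet)
        rw [← Ideal.Quotient.eq_zero_iff_mem, RingHom.map_det]
        refine det_eq_zero_of_row_eq_zero (Sum.inl ()) ?_
        rintro (i | i)
        · exact Ideal.Quotient.eq_zero_iff_mem.2 ha
        · exact Ideal.Quotient.eq_zero_iff_mem.2 (hb i))
    let Q : Matrix (Unit ⊕ ι) (Unit ⊕ ι) R := fromBlocks 1 0 (replicateCol Unit w) 1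
    have hQ : Q.det = 1 := by simp [Q]
    refine .of_congr (Q := Q) (by simp [hQ]) (this _ ?_ ?_ ?_)
    · rw [IsSymm, transpose_mul, transpose_mul, transpose_transpose, hS.eq, Matrix.mul_assoc]
    · simpa [hQ] using hdet
    · convert hw using 1
      have hS' : ∀ i, S (Sum.inr i) (Sum.inl ()) = S (Sum.inl ()) (Sum.inr i) := fun i =>
        hS.apply _ _
      simp [Q, mul_apply, fromBlocks, dotProduct, mulVec, toBlocks₂₂, hS', Finset.sum_add_distrib,
        Finset.mul_sum, Finset.sum_mul, add_mul]
      rw [Finset.sum_comm]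
      simp only [two_mul, Finset.sum_add_distrib, mul_assoc, mul_comm (w _) (S (Sum.inl ()) _)]
      ring
  obtain ⟨A, B, C, D, rfl⟩ : ∃ A B C D, S = fromBlocks A B C D :=
    ⟨_, _, _, _, (fromBlocks_toBlocks S).symm⟩
  obtain ⟨hA, hBC, hCB, hD⟩ := isSymm_fromBlocks_iff.1 hS
  subst hBC
  have hAdet : IsUnit A.det := by simpa [det_unique] using hunit
  let _ := invertibleOfIsUnitDet A hAdet
  have hAinv : (⅟A)ᵀ = ⅟A := by rw [invOf_eq_nonsing_inv, transpose_nonsing_inv, hA.eq]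
  let E := D - Bᵀ * ⅟A * B
  have hE : E.IsSymm := by
    simp only [E, IsSymm, transpose_sub, transpose_mul, transpose_transpose, hD.eq, hAinv,
      Matrix.mul_assoc]
  rw [det_fromBlocks₁₁] at hdet
  obtain ⟨P, d, hP, hPd⟩ := ih E hE (isUnit_of_mul_isUnit_right hdet)
  have hdiag : (fromBlocks A 0 0 E).IsCongruentToDiagonal := by
    refine ⟨fromBlocks 1 0 0 P, Sum.elim (fun _ => A () ()) d, by simpa using hP, ?_⟩
    rw [← fromBlocks_diagonal]
    simp only [fromBlocks_transpose, fromBlocks_multiply, hPd]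
    have : A = diagonal fun _ => A () () := by ext; simp
    simp [← this]
  rw [fromBlocks_eq_of_invertible₁₁]
  convert hdiag.congr (Q := fromBlocks 1 (⅟A * B) 0 1) (by simp) using 3
  simp only [fromBlocks_transpose, transpose_mul, hAinv, transpose_one, transpose_zero]

/-- Over a semilocal ring in which `2` is invertible, unimodular symmetric forms on free modules
have orthogonal bases. -/
theorem Matrix.isCongruentToDiagonal_of_isSymm [Finite (MaximalSpectrum R)] (h2 : IsUnit (2 : R))
    {n : ℕ} (S : Matrix (Fin n) (Fin n) R) (hS : S.IsSymm) (hdet : IsUnit S.det) :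
    S.IsCongruentToDiagonal := by
  induction n with
  | zero => exact ⟨1, 0, by simp, Subsingleton.elim _ _⟩
  | succ n ih =>
    let e : Unit ⊕ Fin n ≃ Fin (n + 1) := Fintype.equivOfCardEq (by simp [add_comm])
    refine .of_submatrix e (isCongruentToDiagonal_sum h2 ih _ (hS.submatrix e) ?_)
    rwa [det_submatrix_equiv_self]

end Diagonalization

namespace OrI

variable {R : Type u} [CommRing R]

/-- The free module with an orthogonal basis whose vectors have norms `a i`. -/
noncomputable def diag {n : ℕ} (a : Fin n → Rˣ) : OrI R where
  carrier := Fin n → R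
  form := LinearMap.mk₂ R (fun v w => ∑ i, a i * (v i * w i))
    (by intros; simp [add_mul, mul_add, Finset.sum_add_distrib])
    (by intros; simp [Finset.mul_sum]; exact Finset.sum_congr rfl fun _ _ => by ring)
    (by intros; simp [mul_add, Finset.sum_add_distrib])
    (by intros; simp [Finset.mul_sum]; exact Finset.sum_congr rfl fun _ _ => by ring)
  symm v w := by simp [mul_comm (v _)]
  nondegenerate := by
    constructor
    · refine (injective_iff_map_eq_zero _).2 fun v hv => funext fun i => ?_
      have := LinearMap.congr_fun hv (Pi.single i 1)
      simpa [Pi.single_apply] using this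
    · intro l
      refine ⟨fun i => ↑(a i)⁻¹ * l (Pi.single i 1), ?_⟩
      refine LinearMap.pi_ext' fun i => LinearMap.ext_ring ?_
      simp [Pi.single_apply]

theorem diag_form {n : ℕ} (a : Fin n → Rˣ) (v w : Fin n → R) :
    (diag a).form v w = ∑ i, a i * (v i * w i) := rfl

/-- A bijective isometry is an isomorphism. -/
def isoOfLinearEquiv {V W : OrI R} (e : V ≃ₗ[R] W)
    (he : ∀ v w, W.form (e v) (e w) = V.form v w) : V ≅ W where
  hom := (⟨e, he⟩ : Hom V W)
  inv := (⟨e.symm, fun v w => by rw [← he]; simp⟩ : Hom W V)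
  hom_inv_id := Hom.ext (LinearMap.ext fun v => e.symm_apply_apply v)
  inv_hom_id := Hom.ext (LinearMap.ext fun v => e.apply_symm_apply v)

open Matrix in
/-- Orthogonal modules over a finite ring in which `2` is invertible have orthogonal bases. -/
theorem exists_iso_diag [Finite R] (h2 : IsUnit (2 : R)) (V : OrI R) :
    ∃ (n : ℕ) (a : Fin n → Rˣ), Nonempty (V ≅ diag a) := by
  let b := (Module.Free.chooseBasis R V).reindex (Fintype.equivFin _)
  let S : Matrix _ _ R := Matrix.of fun i j => V.form (b i) (b j)
  have hS : S.IsSymm := by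
    ext i j
    exact V.symm _ _
  have hdet : IsUnit S.det := by
    have h := LinearEquiv.isUnit_det (LinearEquiv.ofBijective V.form V.nondegenerate) b b.dualBasis
    convert h using 2
    ext i j
    simp [S, LinearMap.toMatrix_apply, V.symm (b i)]
  obtain ⟨P, d, hP, hSP⟩ := isCongruentToDiagonal_of_isSymm h2 S hS hdet
  have hd : ∀ i, IsUnit (d i) := by
    rw [hSP, det_mul, det_mul, det_diagonal] at hdet
    have := isUnit_of_mul_isUnit_right (isUnit_of_mul_isUnit_left hdet)
    exact fun i => isUnit_of_dvd_unit (Finset.dvd_prod_of_mem d (Finset.mem_univ i)) this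
  let e : V ≃ₗ[R] (diag fun i => (hd i).unit) :=
    b.equivFun.trans (Matrix.toLinearEquiv' P (invertibleOfIsUnitDet P hP))
  refine ⟨_, _, ⟨isoOfLinearEquiv e ?_⟩⟩
  have heb : ∀ i, e (b i) = fun k => P k i := by
    intro i
    have hb : b.equivFun (b i) = Pi.single i 1 := by
      funext k
      simp [Module.Basis.equivFun_self, Pi.single_apply, eq_comm]
    exact (congrArg (P *ᵥ ·) hb).trans (mulVec_single_one P i)
  have hform : (diag fun i => (hd i).unit).form.compl₁₂ (e : V →ₗ[R] _) (e : V →ₗ[R] _) =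
      V.form := by
    refine LinearMap.ext_basis b b fun i j => ?_
    have hij : V.form (b i) (b j) = ∑ k, P k i * d k * P k j := by
      have := congrFun (congrFun hSP i) j
      rw [Matrix.mul_apply] at this
      simpa only [S, of_apply, mul_diagonal, transpose_apply] using this
    rw [hij, LinearMap.compl₁₂_apply, LinearEquiv.coe_coe, heb, heb, diag_form]
    exact Finset.sum_congr rfl fun k _ => by simp; ring
  exact fun v w => LinearMap.congr_fun₂ hform v w

/-- Pulling back along `f` replaces the `i`-th vector of the orthogonal basis by the sum of the
basis vectors in the fibre over `i`. -/
noncomputable def diagPullback {n n' : ℕ} {a : Fin n → Rˣ} {a' : Fin n' → Rˣ}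
    {f : Fin n' → Fin n} (hf : IsUnimodularSurjection R f) (ha : ∀ j, a' j = a (f j)) :
    diag a ⟶ diag a' :=
  (⟨LinearMap.funLeft R R f, fun v w => by
    change ∑ j, (a' j : R) * (v (f j) * w (f j)) = ∑ i, a i * (v i * w i)
    simp only [ha]
    exact hf.sum_comp fun i => a i * (v i * w i)⟩ : Hom (diag a) (diag a'))

end OrI

/-! ### Noetherianity of free modules over the category of isometries -/

/-- If `a` and `b` first differ at `i`, then `a ∘ f` and `b ∘ f` first differ at the first element of
the fibre of `f` over `i`. -/
theorem IsUnimodularSurjection.lex_lt {R : Type*} [CommRing R] {n n' : ℕ} {f : Fin n' → Fin n}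
    (hf : IsUnimodularSurjection R f) {A : Type*} [LinearOrder A] {a b : Fin n → A}
    (h : toLex a < toLex b) : toLex (a ∘ f) < toLex (b ∘ f) := by
  obtain ⟨g, hg, hg'⟩ := hf.exists_section
  obtain ⟨i, hi, hlt⟩ := h
  refine ⟨g i, fun j hj => hi _ (hg' i j hj), ?_⟩
  change a (f (g i)) < b (f (g i))
  rw [hg]
  exact hlt

namespace OrI

variable {R : Type u} [CommRing R] {m : ℕ} {C : Fin m → OrI R}

/-- The basis at `V` of the `OrI R`-module `⨁ i, K[Hom(C i, -)]`. -/
abbrev Monomial (C : Fin m → OrI R) (V : OrI R) : Type u := Σ i, C i ⟶ V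

/-- Composition with an isometry. -/
def Monomial.map {V W : OrI R} (h : V ⟶ W) (p : Monomial C V) : Monomial C W :=
  ⟨p.1, p.2 ≫ h⟩

theorem Monomial.map_id (V : OrI R) : Monomial.map (C := C) (𝟙 V) = id := by
  funext p
  simp [Monomial.map]

theorem Monomial.map_comp {U V W : OrI R} (g : U ⟶ V) (h : V ⟶ W) :
    Monomial.map (C := C) (g ≫ h) = Monomial.map h ∘ Monomial.map g := by
  funext p
  simp [Monomial.map]

instance [Finite R] (V : OrI R) : Finite V := Module.finite_of_finite R

instance [Finite R] (V W : OrI R) : Finite (V ⟶ W) :=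
  Finite.of_injective (fun f : V ⟶ W => fun v : V => Hom.toLinearMap f v)
    fun _ _ h => Hom.ext (LinearMap.ext fun v => congrFun h v)

instance [Finite R] (V : OrI R) : Finite (Monomial C V) :=
  inferInstanceAs (Finite (Σ i, C i ⟶ V))

/-- An isometry `C i ⟶ diag a` as the word of its coordinates, which are linear forms on `C i`. -/
def Monomial.word {n : ℕ} {a : Fin n → Rˣ} (p : Monomial C (diag a)) (j : Fin n) :
    Σ i, Module.Dual R (C i) :=
  ⟨p.1, (LinearMap.proj j : (Fin n → R) →ₗ[R] R) ∘ₗ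
    (Hom.toLinearMap p.2 : C p.1 →ₗ[R] (Fin n → R))⟩

theorem Monomial.ext_word {n : ℕ} {a : Fin n → Rˣ} {p q : Monomial C (diag a)}
    (h1 : p.1 = q.1) (h2 : p.word = q.word) : p = q := by
  obtain ⟨i, f⟩ := p
  obtain ⟨i', g⟩ := q
  obtain rfl : i = i' := h1
  refine congrArg (Sigma.mk i) (Hom.ext (LinearMap.ext fun v => funext fun j => ?_))
  have := congrFun h2 j
  simp only [Monomial.word, Sigma.mk.injEq, heq_eq_eq, true_and] at this
  exact LinearMap.congr_fun this v

/-- The free `OrI R`-module `⨁ i, K[Hom(C i, -)]` is noetherian. The Gröbner argument is applied to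
its values at the modules `diag a`, which represent all isomorphism classes, and to those isometries
which are strictly monotone on words. -/
theorem exists_finite_generators [Finite R] (h2 : IsUnit (2 : R)) {K : Type w} [Ring K]
    [IsNoetherianRing K] (C : Fin m → OrI R) {S : ∀ V, Submodule K (Monomial C V →₀ K)}
    (hS : IsStableFamily (fun V W => Set.range (Monomial.map (V := V) (W := W))) S) :
    ∃ E : Set (Σ V, Monomial C V →₀ K), E.Finite ∧ (∀ e ∈ E, e.2 ∈ S e.1) ∧
      ∀ S' : ∀ V, Submodule K (Monomial C V →₀ K),
        IsStableFamily (fun V W => Set.range (Monomial.map (V := V) (W := W))) S' →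
        (∀ e ∈ E, e.2 ∈ S' e.1) → ∀ V, S V ≤ S' V := by
  -- The letters are ordered arbitrarily, the words of a given length lexicographically.
  let L := Σ i, Module.Dual R (C i)
  have : ∀ i, Finite (Module.Dual R (C i)) := fun i => DFunLike.finite _
  have : Finite L := inferInstanceAs (Finite (Σ i, Module.Dual R (C i)))
  let _ : LinearOrder L := LinearOrder.lift' (Finite.equivFin L) (Finite.equivFin L).injective
  let O := Σ n, Fin n → Rˣ
  let B : O → Type u := fun o => Monomial C (diag o.2)
  let key : ∀ o, B o → Fin m ×ₗ Lex (Fin o.1 → L) := fun o p => toLex (p.1, toLex p.word)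
  have hkey : ∀ o, Function.Injective (key o) := fun o p q h =>
    Monomial.ext_word (congrArg (fun z => (ofLex z).1) h)
      (congrArg (fun z => ofLex (ofLex z).2) h)
  let _ : ∀ o, LinearOrder (B o) := fun o => LinearOrder.lift' (key o) (hkey o)
  have : ∀ o, Finite (B o) := fun o => inferInstanceAs (Finite (Monomial C (diag o.2)))
  let T : ∀ o o', Set (B o → B o') := fun o o' =>
    {F | StrictMono F ∧ F ∈ Set.range (Monomial.map (V := diag o.2) (W := diag o'.2))}
  have hwqo : ∀ s : ℕ → Σ o, B o, ∃ φ : ℕ ↪o ℕ, ∀ k l, k < l →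
      ∃ f ∈ T (s (φ k)).1 (s (φ l)).1, f (s (φ k)).2 = (s (φ l)).2 := by
    intro s
    obtain ⟨φ, i, hφ⟩ := exists_subseq_const fun k => (s k).2.1
    -- Each letter also carries the norm of its basis vector, so that norms match as well.
    obtain ⟨ψ, hψ⟩ := exists_subseq_isUnimodularSurjection R
      (fun k => (⟨(s (φ k)).1.1, fun j => ((s (φ k)).2.word j, (s (φ k)).1.2 j)⟩ :
        Σ n, Fin n → L × Rˣ))
    refine ⟨ψ.trans φ, fun k l hkl => ?_⟩
    obtain ⟨f, hf, hff⟩ := hψ k l hkl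
    have ha : ∀ j, (s (φ (ψ l))).1.2 j = (s (φ (ψ k))).1.2 (f j) := fun j =>
      congrArg Prod.snd (congrFun hff j)
    refine ⟨Monomial.map (diagPullback hf ha), ⟨?_, _, rfl⟩, ?_⟩
    · intro p q hpq
      -- The order on `B o` is by definition that of the keys, and the word of the image of `p` is
      -- by definition `p.word ∘ f`.
      rcases Prod.Lex.lt_iff.1 (show key _ p < key _ q from hpq) with h | ⟨h, h'⟩
      · exact Prod.Lex.lt_iff.2 (Or.inl h)
      · exact Prod.Lex.lt_iff.2 (Or.inr ⟨h, hf.lex_lt h'⟩)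
    · exact Monomial.ext_word ((hφ (ψ k)).trans (hφ (ψ l)).symm)
        (funext fun j => (congrArg Prod.fst (congrFun hff j)).symm)
  obtain ⟨E, hE, hES, hgen⟩ := exists_finite_generators_of_wqo (T := T)
    (fun _ _ _ hf => hf.1) hwqo (S := fun o => S (diag o.2)) (fun _ _ f hf => hS f hf.2)
  refine ⟨(fun e => ⟨diag e.1.2, e.2⟩) '' E, hE.image _, ?_, ?_⟩
  · rintro _ ⟨e, he, rfl⟩
    exact hES e he
  · intro S' hS' hES' V p hp
    obtain ⟨n, a, ⟨e⟩⟩ := exists_iso_diag h2 V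
    have h1 := hgen (fun o => S' (diag o.2)) (fun _ _ f hf => hS' f hf.2)
      (fun e he => hES' _ ⟨e, he, rfl⟩) ⟨n, a⟩ (hS _ ⟨e.hom, rfl⟩ p hp)
    have h3 := hS' _ ⟨e.inv, rfl⟩ _ h1
    rwa [← LinearMap.comp_apply, ← Finsupp.lmapDomain_comp, ← Monomial.map_comp, e.hom_inv_id,
      Monomial.map_id, Finsupp.lmapDomain_id, LinearMap.id_apply] at h3

end OrI

/-! ### Finite presentation and Kan extension -/

namespace OrI

variable {R : Type u} [CommRing R] {m : ℕ} {C : Fin m → OrI R} {K : Type w} [Ring K]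

/-- The map `⨁ i, K[Hom(C i, -)] ⟶ M` given by elements `y i ∈ M (C i)`. -/
noncomputable def evalMonomials (M : OrI R ⥤ ModuleCat.{x} K) (y : ∀ i, M.obj (C i)) (V : OrI R) :
    (Monomial C V →₀ K) →ₗ[K] M.obj V :=
  Finsupp.linearCombination K fun p : Monomial C V => M.map p.2 (y p.1)

theorem evalMonomials_single (M : OrI R ⥤ ModuleCat.{x} K) (y : ∀ i, M.obj (C i)) {V : OrI R}
    (p : Monomial C V) (k : K) :
    evalMonomials M y V (Finsupp.single p k) = k • M.map p.2 (y p.1) :=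
  Finsupp.linearCombination_single K k p

theorem evalMonomials_lmapDomain (M : OrI R ⥤ ModuleCat.{x} K) (y : ∀ i, M.obj (C i))
    {V W : OrI R} (h : V ⟶ W) (p : Monomial C V →₀ K) :
    evalMonomials M y W (Finsupp.lmapDomain K K (Monomial.map h) p) =
      M.map h (evalMonomials M y V p) := by
  have : evalMonomials M y W ∘ₗ Finsupp.lmapDomain K K (Monomial.map h) =
      (M.map h).hom ∘ₗ evalMonomials M y V := by
    refine Finsupp.lhom_ext fun p k => ?_
    simp [evalMonomials_single, Monomial.map]
  exact LinearMap.congr_fun this p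

theorem isStableFamily_ker_evalMonomials (M : OrI R ⥤ ModuleCat.{x} K) (y : ∀ i, M.obj (C i)) :
    IsStableFamily (fun V W => Set.range (Monomial.map (C := C) (V := V) (W := W)))
      fun V => LinearMap.ker (evalMonomials M y V) := by
  rintro V W _ ⟨h, rfl⟩ p hp
  rw [LinearMap.mem_ker] at hp ⊢
  rw [evalMonomials_lmapDomain, hp, map_zero]

theorem evalMonomials_surjective (M : OrI R ⥤ ModuleCat.{x} K) (y : ∀ i, M.obj (C i))
    (hy : ∀ S : CatSubmodule M, (∀ i, y i ∈ S.obj (C i)) → ∀ V, S.obj V = ⊤) (V : OrI R) :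
    Function.Surjective (evalMonomials M y V) := by
  rw [← LinearMap.range_eq_top]
  refine hy ⟨fun V => LinearMap.range (evalMonomials M y V), ?_⟩ (fun i => ?_) V
  · rintro V W h _ ⟨p, rfl⟩
    exact ⟨_, evalMonomials_lmapDomain M y h p⟩
  · exact ⟨Finsupp.single ⟨i, 𝟙 _⟩ 1, by simp [evalMonomials_single]⟩

/-- A transformation defined on the generators of `M` which respects the relations between them
extends to `M`. -/
theorem exists_natTrans_of_ker_le (M G : OrI R ⥤ ModuleCat.{x} K) (y : ∀ i, M.obj (C i))
    (z : ∀ i, G.obj (C i)) (hy : ∀ V, Function.Surjective (evalMonomials M y V))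
    (hker : ∀ V, LinearMap.ker (evalMonomials M y V) ≤ LinearMap.ker (evalMonomials G z V)) :
    ∃ β : M ⟶ G, ∀ V p, β.app V (evalMonomials M y V p) = evalMonomials G z V p := by
  let l : ∀ V, M.obj V →ₗ[K] G.obj V := fun V =>
    (LinearMap.ker (evalMonomials M y V)).liftQ (evalMonomials G z V) (hker V) ∘ₗ
      ((evalMonomials M y V).quotKerEquivOfSurjective (hy V)).symm
  have hl : ∀ V p, l V (evalMonomials M y V p) = evalMonomials G z V p := by
    intro V p
    have : ((evalMonomials M y V).quotKerEquivOfSurjective (hy V)).symm (evalMonomials M y V p) =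
        Submodule.Quotient.mk p := by
      rw [LinearEquiv.symm_apply_eq]
      rfl
    simp only [l, LinearMap.comp_apply, LinearEquiv.coe_coe, this]
    exact Submodule.liftQ_apply _ _ _
  refine ⟨{ app := fun V => ModuleCat.ofHom (l V), naturality := fun V W h => ?_ }, hl⟩
  refine ModuleCat.hom_ext (LinearMap.ext fun q => ?_)
  obtain ⟨p, rfl⟩ := hy V q
  change l W (M.map h _) = G.map h (l V _)
  rw [← evalMonomials_lmapDomain, hl, hl, evalMonomials_lmapDomain]

end OrI

theorem mainTheorem4 (R : Type u) [CommRing R] [Finite R] (h2 : IsUnit (2 : R))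
    (K : Type w) [Ring K] [IsNoetherianRing K]
    (M : OrI R ⥤ ModuleCat.{x} K) (hM : IsFinitelyGenerated M) :
    ∃ N₀ : ℕ, ∀ N : ℕ, N₀ ≤ N →
      M.IsLeftKanExtension (𝟙 ((OrI.rankLE R N).ι ⋙ M)) := by
  obtain ⟨m, C, y, hy⟩ := hM
  have hsurj := OrI.evalMonomials_surjective M y hy
  obtain ⟨E, hE, hEker, hgen⟩ := OrI.exists_finite_generators h2 C
    (OrI.isStableFamily_ker_evalMonomials M y)
  obtain ⟨N₁, hN₁⟩ := (Set.finite_range fun i => Module.finrank R (C i)).bddAbove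
  obtain ⟨N₂, hN₂⟩ := (hE.image fun e : Σ V, OrI.Monomial C V →₀ K => Module.finrank R e.1).bddAbove
  refine ⟨max N₁ N₂ + 1, fun N hN => ⟨⟨?_⟩⟩⟩
  have hC : ∀ i, OrI.rankLE R N (C i) := fun i => Or.inl <| by
    have : Module.finrank R (C i) ≤ N₁ := hN₁ ⟨i, rfl⟩
    omega
  have hEN : ∀ e ∈ E, OrI.rankLE R N e.1 := fun e he => Or.inl <| by
    have : Module.finrank R e.1 ≤ N₂ := hN₂ ⟨e, he, rfl⟩
    omega
  -- A transformation on the objects of small rank respects the relations in `E`, hence all of them.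
  have hex : ∀ G : (OrI.rankLE R N).ι.LeftExtension ((OrI.rankLE R N).ι ⋙ M),
      ∃ β : M ⟶ G.right, Functor.whiskerLeft (OrI.rankLE R N).ι β = G.hom := by
    intro G
    let z : ∀ i, G.right.obj (C i) := fun i => G.hom.app ⟨C i, hC i⟩ (y i)
    have hz : ∀ V (hV : OrI.rankLE R N V) (p : OrI.Monomial C V →₀ K),
        G.hom.app ⟨V, hV⟩ (OrI.evalMonomials M y V p) = OrI.evalMonomials G.right z V p := by
      intro V hV p
      have : (G.hom.app ⟨V, hV⟩).hom ∘ₗ OrI.evalMonomials M y V =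
          OrI.evalMonomials G.right z V := by
        refine Finsupp.lhom_ext fun p k => ?_
        have hnat := ConcreteCategory.congr_hom (G.hom.naturality
          (X := ⟨C p.1, hC p.1⟩) (Y := ⟨V, hV⟩) (ObjectProperty.homMk p.2)) (y p.1)
        rw [LinearMap.comp_apply, OrI.evalMonomials_single, OrI.evalMonomials_single, map_smul]
        exact congrArg (k • ·) hnat
      exact LinearMap.congr_fun this p
    obtain ⟨β, hβ⟩ := OrI.exists_natTrans_of_ker_le M G.right y z hsurj
      (hgen _ (OrI.isStableFamily_ker_evalMonomials G.right z) fun e he => by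
        rw [LinearMap.mem_ker, ← hz e.1 (hEN e he), LinearMap.mem_ker.1 (hEker e he), map_zero])
    refine ⟨β, NatTrans.ext (funext fun V => ModuleCat.hom_ext (LinearMap.ext fun q => ?_))⟩
    obtain ⟨p, rfl⟩ := hsurj V.obj q
    exact (hβ V.obj p).trans (hz V.obj V.property p).symm
  -- The submodule on which two transformations agree contains the generators of `M`.
  have huniq : ∀ (G : OrI R ⥤ ModuleCat.{x} K) (β γ : M ⟶ G),
      Functor.whiskerLeft (OrI.rankLE R N).ι β = Functor.whiskerLeft (OrI.rankLE R N).ι γ →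
        β = γ := by
    intro G β γ h
    refine NatTrans.ext (funext fun V => ModuleCat.hom_ext (LinearMap.ext fun q => ?_))
    have htop := hy ⟨fun V => LinearMap.eqLocus (β.app V).hom (γ.app V).hom, ?_⟩ ?_ V
    · exact htop.ge Submodule.mem_top
    · intro V W f q hq
      have h1 := ConcreteCategory.congr_hom (β.naturality f) q
      have h2 := ConcreteCategory.congr_hom (γ.naturality f) q
      exact h1.trans ((congrArg (G.map f) hq).trans h2.symm)
    · exact fun i => ConcreteCategory.congr_hom (NatTrans.congr_app h ⟨C i, hC i⟩) (y i)
  choose β hβ using hex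
  refine Limits.IsInitial.ofUniqueHom (fun G => StructuredArrow.homMk (β G) ?_) fun G f => ?_
  · exact (Category.id_comp _).trans (hβ G)
  · refine StructuredArrow.hom_ext _ _ (huniq _ _ _ ?_)
    exact ((Category.id_comp _).symm.trans (StructuredArrow.w f)).trans (hβ G).symm
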